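/- Let $L^2[0,1]$ be the Hilbert space of real square-integrable functions on $[0,1]$, with inner product $\langle\cdot,\cdot\rangle$ and norm $\|\cdot\|$, and let $(\rho_j)_{j\ge 1}$ be an orthonormal basis of it. For $p\ge 1$ let $\mathcal S^p=\{\gamma\in\mathbb R^p:\|\gamma\|=1\}$ be the Euclidean unit sphere with its Lebesgue (surface) measure, which for $p=1$ is the counting measure on $\{-1,1\}$; identify $\gamma\in\mathbb R^p$ with $\sum_{j=1}^p\gamma_j\rho_j\in L^2[0,1]$. Let $U$ and $X$ be $L^2[0,1]$-valued random variables on a common probability space with $\mathbb E\|U\|<\infty$. For $\gamma\in\mathcal S^p$ let $F_\gamma(t)=\mathbb P(\langle X,\gamma\rangle\le t)$, $t\in\mathbb R$, and $$Q(\gamma)=\mathbb E\big[\langle U,\ \mathbb E\{U\mid F_\gamma(\langle X,\gamma\rangle)\}\rangle\big],$$ where the outer expectation is taken in $[-\infty,\infty]$ and is said to be well defined if the positive part or the negative part of the integrand has finite expectation. The following statements are equivalent: 1. $\mathbb E(U\mid X)=0$ almost surely. 2. For every $p\ge 1$ and every Lebesgue measurable set $B_p\subset\mathcal S^p$ of strictly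 positive Lebesgue measure on $\mathcal S^p$, $Q(\gamma)$ is well defined for all $\gamma\in B_p$ and $$\max_{\gamma\in B_p}Q(\gamma)=0 .$$ -/

import Mathlib

open MeasureTheory ProbabilityTheory

/-- The Hilbert space `L²[0,1]` of (classes of) real square-integrable functions on `[0,1]`. -/
abbrev L2I : Type := Lp ℝ 2 ((volume : Measure ℝ).restrict (Set.Icc (0 : ℝ) 1))

/-- `L²[0,1]` carries its Borel σ-algebra. -/
noncomputable instance L2I.instMeasurableSpace : MeasurableSpace L2I := borel L2I

instance L2I.instBorelSpace : BorelSpace L2I := ⟨rfl⟩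

/-- The unit hypersphere `{γ ∈ ℝᵖ : ‖γ‖ = 1}` for the Euclidean norm. -/
abbrev UnitSphere (p : ℕ) : Type := Metric.sphere (0 : EuclideanSpace ℝ (Fin p)) 1

/-- Lebesgue (surface) measure on the unit hypersphere of `ℝᵖ`. -/
noncomputable abbrev sphereMeasure (p : ℕ) : Measure (UnitSphere p) :=
  (volume : Measure (EuclideanSpace ℝ (Fin p))).toSphere

/-- The element `∑_{j ≤ p} γ_j ρ_j` of `L²[0,1]` identified with `γ ∈ ℝᵖ`. -/
noncomputable def direction (ρ : HilbertBasis ℕ ℝ L2I) {p : ℕ}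
    (γ : EuclideanSpace ℝ (Fin p)) : L2I :=
  ∑ j : Fin p, γ j • ρ (j : ℕ)

section

variable {Ω : Type*} [MeasurableSpace Ω]

/-- The expectation of `f` is well defined in `[-∞, ∞]`: the positive part or the negative part
has finite expectation. -/
def ExpectationExists (P : Measure Ω) (f : Ω → ℝ) : Prop :=
  ∫⁻ ω, ENNReal.ofReal (f ω) ∂P ≠ ⊤ ∨ ∫⁻ ω, ENNReal.ofReal (-f ω) ∂P ≠ ⊤

/-- The expectation `E f⁺ - E f⁻` in `[-∞, ∞]`; meaningful when `ExpectationExists P f`. -/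
noncomputable def expectation (P : Measure Ω) (f : Ω → ℝ) : EReal :=
  ((∫⁻ ω, ENNReal.ofReal (f ω) ∂P : ENNReal) : EReal) -
    ((∫⁻ ω, ENNReal.ofReal (-f ω) ∂P : ENNReal) : EReal)

/-- The real random variable `⟨X, γ⟩`. -/
noncomputable def proj (ρ : HilbertBasis ℕ ℝ L2I) (X : Ω → L2I) {p : ℕ}
    (γ : EuclideanSpace ℝ (Fin p)) (ω : Ω) : ℝ :=
  inner ℝ (X ω) (direction ρ γ)

/-- The distribution function `F_γ(t) = P(⟨X, γ⟩ ≤ t)`. -/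
noncomputable def projCDF (P : Measure Ω) (ρ : HilbertBasis ℕ ℝ L2I) (X : Ω → L2I) {p : ℕ}
    (γ : EuclideanSpace ℝ (Fin p)) (t : ℝ) : ℝ :=
  P.real {ω | proj ρ X γ ω ≤ t}

/-- The conditional expectation `E{U | F_γ(⟨X, γ⟩)}`. -/
noncomputable def condProj (P : Measure Ω) (ρ : HilbertBasis ℕ ℝ L2I) (U X : Ω → L2I) {p : ℕ}
    (γ : EuclideanSpace ℝ (Fin p)) : Ω → L2I :=
  P[U | MeasurableSpace.comap (fun ω => projCDF P ρ X γ (proj ρ X γ ω)) inferInstance]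

/-- The random variable `⟨U, E{U | F_γ(⟨X, γ⟩)}⟩`. -/
noncomputable def qVar (P : Measure Ω) (ρ : HilbertBasis ℕ ℝ L2I) (U X : Ω → L2I) {p : ℕ}
    (γ : EuclideanSpace ℝ (Fin p)) (ω : Ω) : ℝ :=
  inner ℝ (U ω) (condProj P ρ U X γ ω)

/-- `Q(γ) = E⟨U, E{U | F_γ(⟨X, γ⟩)}⟩`, an expectation in `[-∞, ∞]`. -/
noncomputable def Q (P : Measure Ω) (ρ : HilbertBasis ℕ ℝ L2I) (U X : Ω → L2I) {p : ℕ}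
    (γ : EuclideanSpace ℝ (Fin p)) : EReal :=
  expectation P (qVar P ρ U X γ)

/-- The null hypothesis `E(U | X) = 0` almost surely. -/
def NullHypothesis (P : Measure Ω) (U X : Ω → L2I) : Prop :=
  P[U | MeasurableSpace.comap X inferInstance] =ᵐ[P] 0

end

open Filter Topology Set
open scoped ENNReal

/-- Almost no mass lies to the right of `t` in the region where the distribution function does
not exceed its value at `t`. -/
theorem measure_setOf_lt_and_cdf_le_eq_zero (μ : Measure ℝ) [IsFiniteMeasure μ] (t : ℝ) :
    μ {y | t < y ∧ μ.real (Iic y) ≤ μ.real (Iic t)} = 0 := by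
  have hIoc : ∀ y, t < y → μ.real (Iic y) ≤ μ.real (Iic t) → μ (Ioc t y) = 0 := by
    intro y hty hy
    have h : μ.real (Iic y) = μ.real (Iic t) + μ.real (Ioc t y) := by
      rw [← Iic_union_Ioc_eq_Iic hty.le,
        measureReal_union (Iic_disjoint_Ioc le_rfl) measurableSet_Ioc]
    have h0 : μ.real (Ioc t y) = 0 := le_antisymm (by linarith) measureReal_nonneg
    exact (measureReal_eq_zero_iff).1 h0
  refine measure_null_of_locally_null _ fun y hy => ?_
  by_cases h : ∃ z, y < z ∧ μ.real (Iic z) ≤ μ.real (Iic t)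
  · obtain ⟨z, hyz, hz⟩ := h
    refine ⟨Ioc t z, mem_nhdsWithin.2 ⟨Iio z, isOpen_Iio, hyz, fun w hw => ?_⟩,
      hIoc z (hy.1.trans hyz) hz⟩
    exact ⟨hw.2.1, le_of_lt hw.1⟩
  · push Not at h
    refine ⟨Ioc t y, ?_, hIoc y hy.1 hy.2⟩
    filter_upwards [self_mem_nhdsWithin] with w hw
    exact ⟨hw.1, not_lt.1 fun hlt => absurd hw.2 (not_le.2 (h w hlt))⟩

section ConditionalExpectation

variable {Ω : Type*} {m m₀ : MeasurableSpace Ω} {P : Measure Ω}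
  {E : Type*} [NormedAddCommGroup E] [InnerProductSpace ℝ E] [CompleteSpace E]

/-- For integrable `f`, the set integral vanishes iff the positive and negative parts of `f` have
the same mass on the set. -/
theorem setIntegral_eq_zero_iff_withDensity_eq {f : Ω → ℝ} (hf : Integrable f P) {s : Set Ω}
    (hs : MeasurableSet s) :
    ∫ ω in s, f ω ∂P = 0 ↔ P.withDensity (fun ω => ENNReal.ofReal (f ω)) s =
      P.withDensity (fun ω => ENNReal.ofReal (-f ω)) s := by
  have hpos : ∫⁻ ω in s, ENNReal.ofReal (f ω) ∂P ≠ ⊤ :=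
    hf.integrableOn.lintegral_lt_top.ne
  have hneg : ∫⁻ ω in s, ENNReal.ofReal (-f ω) ∂P ≠ ⊤ :=
    hf.neg.integrableOn.lintegral_lt_top.ne
  rw [withDensity_apply _ hs, withDensity_apply _ hs,
    integral_eq_lintegral_pos_part_sub_lintegral_neg_part hf.integrableOn, sub_eq_zero,
    ENNReal.toReal_eq_toReal_iff' hpos hneg]

/-- On a set where the conditional expectation is bounded, pairing it with the function itself
or with the conditional expectation gives the same integral. -/
theorem setIntegral_inner_condExp_of_bound (hm : m ≤ m₀) [IsFiniteMeasure P] {U : Ω → E}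
    (hU : Integrable U P) {s : Set Ω} (hs : MeasurableSet[m] s) {C : ℝ}
    (hC : ∀ ω ∈ s, ‖(P[U | m]) ω‖ ≤ C) :
    IntegrableOn (fun ω => inner ℝ (U ω) ((P[U | m]) ω)) s P ∧
      IntegrableOn (fun ω => inner ℝ ((P[U | m]) ω) ((P[U | m]) ω)) s P ∧
      ∫ ω in s, inner ℝ (U ω) ((P[U | m]) ω) ∂P =
        ∫ ω in s, inner ℝ ((P[U | m]) ω) ((P[U | m]) ω) ∂P := by
  set V := P[U | m] with hV
  set W : Ω → E := s.indicator V with hW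
  have hWm : StronglyMeasurable[m] W := stronglyMeasurable_condExp.indicator hs
  have hWb : ∀ ω, ‖W ω‖ ≤ max C 0 := by
    intro ω
    by_cases h : ω ∈ s
    · simpa [hW, h] using Or.inl (hC ω h)
    · simp [hW, h]
  have hind : ∀ g : Ω → E, (fun ω => innerSL ℝ (W ω) (g ω)) =
      s.indicator fun ω => inner ℝ (g ω) (V ω) := by
    intro g
    ext ω
    by_cases h : ω ∈ s
    · simp [hW, h, real_inner_comm]
    · simp [hW, h]
  have hint : ∀ g : Ω → E, Integrable g P → Integrable (fun ω => innerSL ℝ (W ω) (g ω)) P :=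
    fun g hg => (innerSL ℝ).integrable_of_bilin_of_bdd_left (max C 0)
      (hWm.mono hm).aestronglyMeasurable (ae_of_all _ hWb) hg
  have hpull := condExp_stronglyMeasurable_bilin_of_bound (innerSL ℝ (E := E)) hm hWm hU
    (max C 0) (ae_of_all _ hWb)
  have hUi := hint U hU
  have hVi := hint V integrable_condExp
  have heq : ∫ ω, innerSL ℝ (W ω) (U ω) ∂P = ∫ ω, innerSL ℝ (W ω) (V ω) ∂P := by
    rw [← integral_condExp hm, integral_congr_ae hpull]
  rw [hind] at hUi hVi
  rw [hind, hind, integral_indicator (hm s hs), integral_indicator (hm s hs)] at heq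
  exact ⟨(integrable_indicator_iff (hm s hs)).1 hUi, (integrable_indicator_iff (hm s hs)).1 hVi,
    heq⟩

/-- The identity `E⟨U, E(U|m)⟩⁺ = E⟨U, E(U|m)⟩⁻ + E‖E(U|m)‖²` in `[0, ∞]`. -/
theorem lintegral_pos_part_inner_condExp (hm : m ≤ m₀) [IsFiniteMeasure P] {U : Ω → E}
    (hU : Integrable U P) :
    ∫⁻ ω, ENNReal.ofReal (inner ℝ (U ω) ((P[U | m]) ω)) ∂P =
      ∫⁻ ω, ENNReal.ofReal (-inner ℝ (U ω) ((P[U | m]) ω)) ∂P +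
        ∫⁻ ω, ENNReal.ofReal (inner ℝ ((P[U | m]) ω) ((P[U | m]) ω)) ∂P := by
  set V := P[U | m] with hV
  set A : ℕ → Set Ω := fun n => {ω | ‖V ω‖ ≤ n} with hA
  have hAm : ∀ n, MeasurableSet[m] (A n) := fun n =>
    stronglyMeasurable_condExp.norm.measurable measurableSet_Iic
  have hmono : Monotone A := fun i j hij ω (hω : ‖V ω‖ ≤ i) =>
    show ‖V ω‖ ≤ j from hω.trans (by exact_mod_cast hij)
  have hUnion : ⋃ n, A n = univ := eq_univ_of_forall fun ω => mem_iUnion.2 (exists_nat_ge ‖V ω‖)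
  have hVm : AEMeasurable (fun ω => ENNReal.ofReal (inner ℝ (V ω) (V ω))) P :=
    ((stronglyMeasurable_condExp.mono hm).inner
      (stronglyMeasurable_condExp.mono hm)).measurable.ennreal_ofReal.aemeasurable
  have hlim : ∀ g : Ω → ℝ≥0∞, ∫⁻ ω, g ω ∂P = ⨆ n, ∫⁻ ω in A n, g ω ∂P := by
    intro g
    rw [← setLIntegral_iUnion_of_directed g hmono.directed_le, hUnion, setLIntegral_univ]
  rw [← lintegral_add_right' _ hVm, hlim, hlim]
  congr 1
  ext1 n
  obtain ⟨hUi, hVi, heq⟩ := setIntegral_inner_condExp_of_bound hm hU (hAm n) (C := n)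
    fun ω hω => hω
  rw [lintegral_add_right' _ hVm.restrict]
  have hp := hUi.lintegral_lt_top.ne
  have hn : ∫⁻ ω in A n, ENNReal.ofReal (-inner ℝ (U ω) (V ω)) ∂P ≠ ⊤ :=
    hUi.neg.lintegral_lt_top.ne
  have hv := hVi.lintegral_lt_top.ne
  rw [integral_eq_lintegral_pos_part_sub_lintegral_neg_part hUi,
    integral_eq_lintegral_of_nonneg_ae (ae_of_all _ fun ω => real_inner_self_nonneg) hVi.1] at heq
  rw [← hV] at heq hp hv
  rw [← ENNReal.toReal_eq_toReal_iff' hp (ENNReal.add_ne_top.2 ⟨hn, hv⟩),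
    ENNReal.toReal_add hn hv]
  linarith

/-- If `E⟨U, E(U|m)⟩` is well defined and nonpositive, then `E(U|m)` vanishes. -/
theorem condExp_eq_zero_of_expectation_inner_le (hm : m ≤ m₀) [IsFiniteMeasure P] {U : Ω → E}
    (hU : Integrable U P)
    (hex : ExpectationExists P fun ω => inner ℝ (U ω) ((P[U | m]) ω))
    (hle : expectation P (fun ω => inner ℝ (U ω) ((P[U | m]) ω)) ≤ 0) :
    P[U | m] =ᵐ[P] 0 := by
  have hkey := lintegral_pos_part_inner_condExp hm hU
  unfold ExpectationExists at hex
  unfold expectation at hle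
  have hVm : Measurable fun ω => ENNReal.ofReal (inner ℝ ((P[U | m]) ω) ((P[U | m]) ω)) :=
    ((stronglyMeasurable_condExp.mono hm).inner
      (stronglyMeasurable_condExp.mono hm)).measurable.ennreal_ofReal
  set a := ∫⁻ ω, ENNReal.ofReal (inner ℝ (U ω) ((P[U | m]) ω)) ∂P
  set b := ∫⁻ ω, ENNReal.ofReal (-inner ℝ (U ω) ((P[U | m]) ω)) ∂P
  have hab : a ≤ b := by
    rw [EReal.sub_nonpos] at hle
    exact_mod_cast hle
  have hb : b ≠ ⊤ := by
    rcases hex with h | h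
    · exact fun hb => h (by rw [hkey, hb, top_add])
    · exact h
  have hc : ∫⁻ ω, ENNReal.ofReal (inner ℝ ((P[U | m]) ω) ((P[U | m]) ω)) ∂P = 0 := by
    rw [hkey] at hab
    by_contra hne
    exact absurd hab (not_le.2 (ENNReal.lt_add_right hb hne))
  filter_upwards [(lintegral_eq_zero_iff hVm).1 hc] with ω hω
  have h0 := ENNReal.ofReal_eq_zero.1 hω
  rw [real_inner_self_eq_norm_sq] at h0
  exact norm_eq_zero.1 (pow_eq_zero_iff two_ne_zero |>.1 (le_antisymm h0 (sq_nonneg _)))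

/-- The σ-algebra of `F(Y)`, with `F` the distribution function of `Y`, is contained in that
of `Y`. -/
theorem comap_cdf_comp_le_comap (P : Measure Ω) [IsFiniteMeasure P] (Y : Ω → ℝ) :
    MeasurableSpace.comap (fun ω => P.real {ω' | Y ω' ≤ Y ω}) inferInstance ≤
      MeasurableSpace.comap Y inferInstance := by
  have hF : Monotone fun t => P.real {ω | Y ω ≤ t} := fun s t hst =>
    measureReal_mono fun ω hω => le_trans hω hst
  exact (hF.measurable.comp (comap_measurable Y)).comap_le

/-- If `E(U | F(Y)) = 0`, where `F` is the distribution function of `Y`, then `U` integrates to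
zero over every sublevel set of `Y`. -/
theorem setIntegral_sublevel_eq_zero_of_condExp_cdf [IsFiniteMeasure P] {U : Ω → E}
    (hU : Integrable U P) {Y : Ω → ℝ} (hY : Measurable Y)
    (h : P[U | MeasurableSpace.comap (fun ω => P.real {ω' | Y ω' ≤ Y ω}) inferInstance] =ᵐ[P] 0)
    (t : ℝ) :
    ∫ ω in {ω | Y ω ≤ t}, U ω ∂P = 0 := by
  have hm := (comap_cdf_comp_le_comap P Y).trans hY.comap_le
  set F : ℝ → ℝ := fun t => P.real {ω | Y ω ≤ t} with hF
  have hFmono : Monotone F := fun s t hst => measureReal_mono fun ω hω => le_trans hω hst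
  have hFμ : ∀ y, (P.map Y).real (Iic y) = F y := fun y =>
    map_measureReal_apply hY measurableSet_Iic
  have hae : {ω | Y ω ≤ t} =ᵐ[P] {ω | F (Y ω) ≤ F t} := by
    have hnull := measure_setOf_lt_and_cdf_le_eq_zero (P.map Y) t
    simp_rw [hFμ] at hnull
    have hnull' : P {ω | t < Y ω ∧ F (Y ω) ≤ F t} = 0 :=
      le_antisymm ((Measure.le_map_apply hY.aemeasurable _).trans hnull.le) zero_le
    have hnot : ∀ᵐ ω ∂P, ¬ (t < Y ω ∧ F (Y ω) ≤ F t) := by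
      rw [ae_iff]; simpa using hnull'
    filter_upwards [hnot] with ω hω
    refine propext ⟨fun h => hFmono h, fun h => ?_⟩
    by_contra hlt
    exact hω ⟨not_le.1 hlt, h⟩
  rw [setIntegral_congr_set hae]
  refine (setIntegral_condExp hm hU ⟨Iic (F t), measurableSet_Iic, rfl⟩).symm.trans ?_
  rw [integral_congr_ae (ae_restrict_of_ae h)]
  simp

end ConditionalExpectation

section Direction

variable (ρ : HilbertBasis ℕ ℝ L2I)

theorem direction_smul {p : ℕ} (c : ℝ) (γ : EuclideanSpace ℝ (Fin p)) :
    direction ρ (c • γ) = c • direction ρ γ := by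
  simp [direction, Finset.smul_sum, mul_smul]

/-- Every element of `L²[0,1]` is a limit of finite-dimensional directions. -/
theorem tendsto_direction_repr (h : L2I) :
    Tendsto (fun n : ℕ =>
      direction ρ (WithLp.toLp 2 fun j : Fin (n + 1) => ρ.repr h j)) atTop (𝓝 h) := by
  have hs := ((ρ.hasSum_repr h).tendsto_sum_nat).comp (tendsto_add_atTop_nat 1)
  refine hs.congr fun n => ?_
  simp only [Function.comp_apply, direction]
  exact Finset.sum_range _

instance L2I.instSecondCountableTopology : SecondCountableTopology L2I :=
  haveI : Fact ((2 : ℝ≥0∞) ≠ ⊤) := ⟨ENNReal.ofNat_ne_top⟩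
  inferInstance

/-- Finite measures on `L²[0,1]` are determined by their images under the one-dimensional
projections along the finite-dimensional unit directions. -/
theorem ext_of_map_inner_direction {μ ν : Measure L2I} [IsFiniteMeasure μ] [IsFiniteMeasure ν]
    (h : ∀ (n : ℕ) (γ : UnitSphere (n + 1)),
      μ.map (fun x => inner ℝ x (direction ρ (γ : EuclideanSpace ℝ (Fin (n + 1))))) =
        ν.map (fun x => inner ℝ x (direction ρ (γ : EuclideanSpace ℝ (Fin (n + 1)))))) :
    μ = ν := by
  have hmap : ∀ (κ : Measure L2I) (v : L2I) (c : ℝ),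
      charFun κ (c • v) = charFun (κ.map fun x => inner ℝ x v) c := by
    intro κ v c
    rw [charFun_apply, charFun_apply_real,
      integral_map (by fun_prop) (by fun_prop)]
    simp [inner_smul_right]
  have hdir : ∀ (n : ℕ) (γ : EuclideanSpace ℝ (Fin (n + 1))),
      charFun μ (direction ρ γ) = charFun ν (direction ρ γ) := by
    intro n γ
    obtain ⟨δ, hδ, c, rfl⟩ : ∃ δ : EuclideanSpace ℝ (Fin (n + 1)), ‖δ‖ = 1 ∧ ∃ c : ℝ, γ = c • δ := by
      rcases eq_or_ne γ 0 with rfl | hγ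
      · exact ⟨EuclideanSpace.single 0 1, by simp, 0, by simp⟩
      · refine ⟨‖γ‖⁻¹ • γ, by simp [norm_smul, hγ], ‖γ‖, ?_⟩
        rw [smul_smul, mul_inv_cancel₀ (norm_ne_zero_iff.2 hγ), one_smul]
    rw [direction_smul, hmap, hmap, h n ⟨δ, by simpa using hδ⟩]
  refine Measure.ext_of_charFun (funext fun v => ?_)
  have hμ := (continuous_charFun (μ := μ)).continuousAt.tendsto.comp (tendsto_direction_repr ρ v)
  have hν := (continuous_charFun (μ := ν)).continuousAt.tendsto.comp (tendsto_direction_repr ρ v)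
  exact tendsto_nhds_unique hμ (hν.congr fun n => (hdir n _).symm)

theorem measurable_proj {Ω : Type*} [MeasurableSpace Ω] {X : Ω → L2I} (hX : Measurable X) {p : ℕ}
    (γ : EuclideanSpace ℝ (Fin p)) :
    Measurable (proj ρ X γ) :=
  (Continuous.measurable (by fun_prop : Continuous fun x : L2I =>
    inner ℝ x (direction ρ γ))).comp hX

theorem comap_proj_le {Ω : Type*} {X : Ω → L2I} {p : ℕ} (γ : EuclideanSpace ℝ (Fin p)) :
    MeasurableSpace.comap (proj ρ X γ) inferInstance ≤
      MeasurableSpace.comap X inferInstance :=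
  (@measurable_proj ρ Ω (MeasurableSpace.comap X inferInstance) X
    (comap_measurable X) p γ).comap_le

end Direction

section MainResult

variable {Ω : Type*} [MeasurableSpace Ω] {P : Measure Ω} [IsProbabilityMeasure P]
  (ρ : HilbertBasis ℕ ℝ L2I) {U X : Ω → L2I}

/-- Under the null hypothesis the conditional expectations along all directions vanish. -/
theorem condProj_eq_zero_of_nullHypothesis (hX : Measurable X) (h : NullHypothesis P U X) {p : ℕ}
    (γ : EuclideanSpace ℝ (Fin p)) : condProj P ρ U X γ =ᵐ[P] 0 := by
  have hle : MeasurableSpace.comap (fun ω => projCDF P ρ X γ (proj ρ X γ ω)) inferInstance ≤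
      MeasurableSpace.comap X inferInstance :=
    (comap_cdf_comp_le_comap P (proj ρ X γ)).trans (comap_proj_le ρ γ)
  refine (condExp_condExp_of_le hle hX.comap_le).symm.trans ?_
  refine (condExp_congr_ae h).trans ?_
  rw [condExp_zero]

/-- If the conditional expectations along all finite-dimensional unit directions vanish, then so
does the conditional expectation given `X`. -/
theorem nullHypothesis_of_condProj_eq_zero (hU : Integrable U P) (hX : Measurable X)
    (h : ∀ (n : ℕ) (γ : UnitSphere (n + 1)),
      condProj P ρ U X (γ : EuclideanSpace ℝ (Fin (n + 1))) =ᵐ[P] 0) :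
    NullHypothesis P U X := by
  have hinner : ∀ v : L2I, ∀ s, MeasurableSet[MeasurableSpace.comap X inferInstance] s →
      ∫ ω in s, inner ℝ v (U ω) ∂P = 0 := by
    rintro v _ ⟨A, hA, rfl⟩
    have hZ : Integrable (fun ω => inner ℝ v (U ω)) P := hU.const_inner v
    have hf₁ := isFiniteMeasure_withDensity_ofReal hZ.2
    have hf₂ : IsFiniteMeasure (P.withDensity fun ω => ENNReal.ofReal (-inner ℝ v (U ω))) :=
      isFiniteMeasure_withDensity_ofReal hZ.neg.2
    have key : (P.withDensity fun ω => ENNReal.ofReal (inner ℝ v (U ω))).map X =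
        (P.withDensity fun ω => ENNReal.ofReal (-inner ℝ v (U ω))).map X := by
      refine ext_of_map_inner_direction ρ fun n γ => Measure.ext_of_Iic _ _ fun t => ?_
      have hY := measurable_proj ρ hX (γ : EuclideanSpace ℝ (Fin (n + 1)))
      rw [Measure.map_map (by fun_prop) hX, Measure.map_map (by fun_prop) hX]
      change Measure.map (proj ρ X (γ : EuclideanSpace ℝ (Fin (n + 1)))) _ _ =
        Measure.map (proj ρ X (γ : EuclideanSpace ℝ (Fin (n + 1)))) _ _
      rw [Measure.map_apply hY measurableSet_Iic, Measure.map_apply hY measurableSet_Iic,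
        ← setIntegral_eq_zero_iff_withDensity_eq hZ (hY measurableSet_Iic),
        integral_inner hU.integrableOn]
      have h0 := setIntegral_sublevel_eq_zero_of_condExp_cdf hU hY (h n γ) t
      change inner ℝ v (∫ ω in {ω | _ ≤ t}, U ω ∂P) = 0
      rw [h0, inner_zero_right]
    rw [setIntegral_eq_zero_iff_withDensity_eq hZ (hX hA), ← Measure.map_apply hX hA, key,
      Measure.map_apply hX hA]
  refine (ae_eq_condExp_of_forall_setIntegral_eq hX.comap_le hU (fun s _ _ => integrableOn_zero)
    (fun s hs _ => ?_) aestronglyMeasurable_zero).symm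
  have h0 := hinner (∫ ω in s, U ω ∂P) s hs
  rw [integral_inner hU.integrableOn, inner_self_eq_zero] at h0
  simp [h0]

theorem sphereMeasure_univ_pos (n : ℕ) : 0 < sphereMeasure (n + 1) univ := by
  have : Nonempty (UnitSphere (n + 1)) := (NormedSpace.sphere_nonempty.2 zero_le_one).to_subtype
  exact isOpen_univ.measure_pos _ univ_nonempty

end MainResult

theorem corollary1 {Ω : Type*} [MeasurableSpace Ω] (P : Measure Ω) [IsProbabilityMeasure P]
    (ρ : HilbertBasis ℕ ℝ L2I) (U X : Ω → L2I) (hU : Integrable U P) (hX : Measurable X) :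
    NullHypothesis P U X ↔
      ∀ p : ℕ, 1 ≤ p → ∀ B : Set (UnitSphere p),
        NullMeasurableSet B (sphereMeasure p) → 0 < sphereMeasure p B →
          (∀ γ ∈ B, ExpectationExists P (qVar P ρ U X (γ : EuclideanSpace ℝ (Fin p)))) ∧
          IsGreatest
            ((fun γ : UnitSphere p => Q P ρ U X (γ : EuclideanSpace ℝ (Fin p))) '' B) 0 := by
  constructor
  · intro h p _ B _ hB
    have hq : ∀ γ : UnitSphere p, qVar P ρ U X (γ : EuclideanSpace ℝ (Fin p)) =ᵐ[P] 0 := by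
      intro γ
      filter_upwards [condProj_eq_zero_of_nullHypothesis ρ hX h
        (γ : EuclideanSpace ℝ (Fin p))] with ω hω
      simp [qVar, hω]
    have hpos : ∀ γ : UnitSphere p,
        ∫⁻ ω, ENNReal.ofReal (qVar P ρ U X (γ : EuclideanSpace ℝ (Fin p)) ω) ∂P = 0 := by
      intro γ
      rw [lintegral_congr_ae ((hq γ).mono fun ω hω => congrArg ENNReal.ofReal hω)]
      simp
    have hneg : ∀ γ : UnitSphere p,
        ∫⁻ ω, ENNReal.ofReal (-qVar P ρ U X (γ : EuclideanSpace ℝ (Fin p)) ω) ∂P = 0 := by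
      intro γ
      rw [lintegral_congr_ae ((hq γ).mono fun ω hω => congrArg (fun x => ENNReal.ofReal (-x)) hω)]
      simp
    have hQ : ∀ γ : UnitSphere p, Q P ρ U X (γ : EuclideanSpace ℝ (Fin p)) = 0 := by
      intro γ
      simp [Q, expectation, hpos γ, hneg γ]
    obtain ⟨γ₀, hγ₀⟩ := nonempty_of_measure_ne_zero hB.ne'
    refine ⟨fun γ _ => Or.inl (by simp [hpos γ]), ⟨γ₀, hγ₀, hQ γ₀⟩, ?_⟩
    rintro _ ⟨γ, _, rfl⟩
    exact (hQ γ).le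
  · intro h
    refine nullHypothesis_of_condProj_eq_zero ρ hU hX fun n γ => ?_
    obtain ⟨hex, -, hub⟩ := h (n + 1) n.succ_pos univ nullMeasurableSet_univ
      (sphereMeasure_univ_pos n)
    have hm := (comap_cdf_comp_le_comap P (proj ρ X (γ : EuclideanSpace ℝ (Fin (n + 1))))).trans
      (measurable_proj ρ hX _).comap_le
    exact condExp_eq_zero_of_expectation_inner_le hm hU (hex γ (mem_univ γ))
      (hub ⟨γ, mem_univ γ, rfl⟩)
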